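/- Setting. Let $G=(V,E)$ be a finite graph, $c$ a number of colors and $(S_i)_{i\in V}$ nonempty sets $S_i\subseteq\{1,\dots,c\}$. In the coordination game with equal-split distribution rule, unit weights and no individual preferences, every player $i\in V$ chooses a color $s_i\in S_i$, and her utility is $u_i(s)=\frac12\,|\{j : \{i,j\}\in E,\ s_i=s_j\}|$; the social welfare is $u(s)=\sum_{i\in V}u_i(s)$. For $\epsilon\ge 1$, a profile $s$ is an $(\epsilon,k)$-equilibrium if for every nonempty set $K\subseteq V$ with $|K|\le k$ and every joint deviation $s'_K\in\prod_{i\in K}S_i$ there is a player $j\in K$ with $u_j(s_{-K},s'_K)\le\epsilon\,u_j(s)$. The $(\epsilon,k)$-Price of Anarchy is the supremum of $u(s^*)/u(s)$ over all $(\epsilon,k)$-equilibria $s$, where $s^*$ is a profile of maximum welfare (it is $\infty$ if $u(s)=0<u(s^*)$ for some such $s$). A sequence of probability distributions $\mathcal F_n$ on $2^{[c_n]}\setminus\{\emptyset\}$ has the common color property if there is a constant $d_0>0$, independent of $n$, such that two independent samples $A^1_n,A^2_n\sim\mathcal F_n$ satisfy $\mathbb P(A_n^1\cap A_n^2\ne\emptyset)\ge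 d_0$ for all $n$. Theorem. Let $\epsilon\ge1$ and $d>0$. There is a constant $\beta=\beta(d,\epsilon)$ such that for every $k\ge2$, every sequence of integers $(c_n)$ with $c_n\ge3$, and every sequence of distributions $(\mathcal F_n)$ on $2^{[c_n]}\setminus\{\emptyset\}$ with the common color property, the following holds. Let $G_n\sim G(n,d/n)$ be the random graph on $n$ nodes, each edge being present independently with probability $d/n$, and let the strategy sets $S_1,\dots,S_n$ be drawn independently from $\mathcal F_n$, independently of $G_n$. Then, with probability tending to $1$ as $n\to\infty$, the $(\epsilon,k)$-Price of Anarchy of the coordination game on $G_n$ with $c_n$ colors, strategy sets $(S_i)$, equal-split distribution rule, unit weights and no individual preferences is at most $\beta$. -/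

import Mathlib

open MeasureTheory Filter Topology
open scoped NNReal ENNReal

/-- A nonempty set of colors from the palette of `c` colors, i.e. an element of `2^[c] \ {∅}`. -/
abbrev StrategySet (c : ℕ) : Type := {S : Finset (Fin c) // S.Nonempty}

/-- A clustering game on the node set `V` with `c > 1` colors. -/
structure ClusteringGame (V : Type*) (c : ℕ) where
  one_lt_colors : 1 < c
  /-- the coordination edges -/
  coord : SimpleGraph V
  /-- the anti-coordination edges -/
  anti : SimpleGraph V
  disjoint : Disjoint coord anti
  /-- the set of colors available to each player -/
  strat : V → StrategySet c
  /-- the split parameters; only the values at pairs of adjacent nodes matter -/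
  split : V → V → ℝ
  split_nonneg : ∀ i j, (coord ⊔ anti).Adj i j → 0 ≤ split i j
  split_add_pos : ∀ i j, (coord ⊔ anti).Adj i j → 0 < split i j + split j i
  /-- the edge weights; only the values at edges matter -/
  weight : Sym2 V → ℝ
  weight_nonneg : ∀ e ∈ (coord ⊔ anti).edgeSet, 0 ≤ weight e
  /-- the individual preferences; only the values at available colors matter -/
  pref : V → Fin c → ℝ
  pref_nonneg : ∀ i, ∀ a ∈ (strat i).1, 0 ≤ pref i a

noncomputable section

namespace ClusteringGame

variable {V : Type*} {c : ℕ}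

/-- The underlying graph, with all edges of both kinds. -/
def graph (Γ : ClusteringGame V c) : SimpleGraph V := Γ.coord ⊔ Γ.anti

/-- All edges are coordination edges. -/
def IsCoordination (Γ : ClusteringGame V c) : Prop := Γ.anti = ⊥

/-- The distribution rule splits every edge equally. -/
def IsEqualSplit (Γ : ClusteringGame V c) : Prop :=
  ∀ i j, Γ.graph.Adj i j → Γ.split i j = Γ.split j i

/-- All edges have weight one. -/
def HasUnitWeights (Γ : ClusteringGame V c) : Prop :=
  ∀ e ∈ Γ.graph.edgeSet, Γ.weight e = 1

/-- There are no individual preferences. -/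
def HasNoPreferences (Γ : ClusteringGame V c) : Prop :=
  ∀ i, ∀ a ∈ (Γ.strat i).1, Γ.pref i a = 0

/-- The strategy profiles: every player chooses a color available to her. -/
def profiles (Γ : ClusteringGame V c) : Set (V → Fin c) :=
  {s | ∀ i, s i ∈ (Γ.strat i).1}

/-- The amount that player `i` obtains from the edge `{i, j}` when it is satisfied. -/
def share (Γ : ClusteringGame V c) (i j : V) : ℝ :=
  Γ.split i j / (Γ.split i j + Γ.split j i) * Γ.weight s(i, j)

open Classical in
/-- The utility of player `i`: her preference for her color plus her shares of the satisfied
incident edges. -/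
def utility [Fintype V] (Γ : ClusteringGame V c) (s : V → Fin c) (i : V) : ℝ :=
  Γ.pref i (s i)
    + ∑ j with Γ.coord.Adj i j ∧ s i = s j, Γ.share i j
    + ∑ j with Γ.anti.Adj i j ∧ s i ≠ s j, Γ.share i j

/-- The utilitarian social welfare. -/
def welfare [Fintype V] (Γ : ClusteringGame V c) (s : V → Fin c) : ℝ :=
  ∑ i, Γ.utility s i

open Classical in
/-- `s` is an `ε`-approximate `k`-strong equilibrium: for every joint deviation `t` of a nonempty
set `K` of at most `k` players, some player of `K` does not improve by more than a factor `ε`. -/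
def IsEquilibrium [Fintype V] (Γ : ClusteringGame V c) (ε : ℝ) (k : ℕ) (s : V → Fin c) : Prop :=
  s ∈ Γ.profiles ∧
    ∀ K : Finset V, K.Nonempty → K.card ≤ k →
      ∀ t : V → Fin c, (∀ i ∈ K, t i ∈ (Γ.strat i).1) →
        ∃ j ∈ K, Γ.utility (K.piecewise t s) j ≤ ε * Γ.utility s j

/-- The welfare of a socially optimal profile. -/
def optWelfare [Fintype V] (Γ : ClusteringGame V c) : ℝ≥0∞ :=
  ⨆ t ∈ Γ.profiles, ENNReal.ofReal (Γ.welfare t)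

/-- The `(ε, k)`-Price of Anarchy of a game, with values in `[0, ∞]`: it is infinite if some
equilibrium has welfare zero while the optimal welfare is positive. -/
def poa [Fintype V] (Γ : ClusteringGame V c) (ε : ℝ) (k : ℕ) : ℝ≥0∞ :=
  ⨆ (s : V → Fin c) (_ : Γ.IsEquilibrium ε k s), Γ.optWelfare / ENNReal.ofReal (Γ.welfare s)

/-- The `(ε, k)`-Price of Anarchy of a class of games. -/
def classPoA [Fintype V] (𝒢 : Set (ClusteringGame V c)) (ε : ℝ) (k : ℕ) : ℝ≥0∞ :=
  ⨆ Γ ∈ 𝒢, Γ.poa ε k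

/-- The coordination games on the graph `G` with strategy sets `S`, equal-split distribution rule,
unit weights and no individual preferences. -/
def unitCoordinationGames (G : SimpleGraph V) (S : V → StrategySet c) :
    Set (ClusteringGame V c) :=
  {Γ | Γ.IsCoordination ∧ Γ.graph = G ∧ Γ.strat = S ∧
    Γ.IsEqualSplit ∧ Γ.HasUnitWeights ∧ Γ.HasNoPreferences}

end ClusteringGame

/-- The common color property of a sequence of distributions of strategy sets: two independent
samples intersect with probability bounded away from zero. -/
def CommonColorProperty {c : ℕ → ℕ} (F : (n : ℕ) → Measure (StrategySet (c n))) : Prop :=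
  ∃ d₀ : ℝ, 0 < d₀ ∧ ∀ n : ℕ,
    d₀ ≤ ((F n).prod (F n)).real {A | (A.1.1 ∩ A.2.1).Nonempty}

/-- The edge probability `d / n`, cut off at `1` (this only matters for `n < d`). -/
def edgeProb (d : ℝ) (n : ℕ) : unitInterval := Set.projIcc 0 1 zero_le_one (d / n)

/-- The joint law of the random graph `G(n, d/n)` and, independently of it, of independent strategy
sets of the `n` players, each with law `F`. -/
def randomInstance (d : ℝ) (n : ℕ) {c : ℕ} (F : Measure (StrategySet c)) :
    Measure (SimpleGraph (Fin n) × (Fin n → StrategySet c)) :=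
  (SimpleGraph.binomialRandom (Fin n) (edgeProb d n)).prod (Measure.pi fun _ => F)

end

/-! Call an edge good if its endpoints share an available color; let N count the good edges and M
the good edges that meet no other edge. A satisfied edge adds 1 to the welfare and must be good, so
the optimum is at most N. In an equilibrium the endpoints of a good isolated edge may jointly move
to a common color (this is where k ≥ 2 enters) and would earn 1/2 each, so one of them already earns
at least 1/(2ε). Isolated edges are disjoint, so the equilibrium welfare is at least M/(2ε), and the
Price of Anarchy is at most 2εN/M (`classPoA_unitCoordinationGames_le`). It remains to compare N
with M. An edge is isolated with conditional probability at least (1 - d/n)^(2n) ≥ exp(-4d) =: a, so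
E M ≥ a E N. By the second moment method N < (3/2) E N and M > (1/2) E M with high probability
(`real_card_isolated_lt_le`), hence N ≤ (3/a) M and β = 6ε exp(4d). The common color bound d₀ enters
only the error terms, so β is independent of it. -/

/-! ### Chebyshev's inequality for counts of events -/

/-- The square of a count expands into indicators of pairwise intersections, so `hv` says that the
variance is at most `v`. -/
theorem measureReal_half_le_abs_count_sub {Ω ι : Type*} [MeasurableSpace Ω]
    (μ : Measure Ω) [IsProbabilityMeasure μ] (I : Finset ι) (A : ι → Set Ω)
    (hA : ∀ i ∈ I, MeasurableSet (A i)) {m v : ℝ} (hm : m = ∑ i ∈ I, μ.real (A i)) (hm0 : 0 < m)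
    (hv : ∑ i ∈ I, ∑ j ∈ I, μ.real (A i ∩ A j) ≤ m ^ 2 + v) :
    μ.real {ω | m / 2 ≤ |∑ i ∈ I, (A i).indicator (fun _ => (1 : ℝ)) ω - m|}
      ≤ 4 * v / m ^ 2 := by
  set X : Ω → ℝ := fun ω => ∑ i ∈ I, (A i).indicator (fun _ => (1 : ℝ)) ω with hX
  have hint : ∀ i ∈ I, Integrable ((A i).indicator (fun _ => (1 : ℝ))) μ := fun i hi =>
    (integrable_const _).indicator (hA i hi)
  have hsq : ∀ ω, X ω ^ 2
      = ∑ i ∈ I, ∑ j ∈ I, (A i ∩ A j).indicator (fun _ => (1 : ℝ)) ω := by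
    intro ω
    simp only [hX, sq, Finset.sum_mul_sum]
    refine Finset.sum_congr rfl fun i _ => Finset.sum_congr rfl fun j _ => ?_
    by_cases h1 : ω ∈ A i <;> by_cases h2 : ω ∈ A j <;> simp [h1, h2]
  have hint2 : ∀ i ∈ I, ∀ j ∈ I, Integrable ((A i ∩ A j).indicator (fun _ => (1 : ℝ))) μ :=
    fun i hi j hj => (integrable_const _).indicator ((hA i hi).inter (hA j hj))
  have hXi : Integrable X μ := integrable_finsetSum _ hint
  have hX2i : Integrable (fun ω => X ω ^ 2) μ := by
    simp only [hsq]
    exact integrable_finsetSum _ fun i hi => integrable_finsetSum _ (hint2 i hi)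
  have hEX : ∫ ω, X ω ∂μ = m := by
    rw [hm, integral_finsetSum _ hint]
    refine Finset.sum_congr rfl fun i hi => ?_
    rw [integral_indicator (hA i hi)]
    simp
  have hEX2 : ∫ ω, X ω ^ 2 ∂μ ≤ m ^ 2 + v := by
    refine le_trans (le_of_eq ?_) hv
    simp only [hsq]
    rw [integral_finsetSum _ fun i hi => integrable_finsetSum _ (hint2 i hi)]
    refine Finset.sum_congr rfl fun i hi => ?_
    rw [integral_finsetSum _ (hint2 i hi)]
    refine Finset.sum_congr rfl fun j hj => ?_
    rw [integral_indicator ((hA i hi).inter (hA j hj))]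
    simp
  have hi3 : Integrable (fun ω => (X ω - m) ^ 2) μ := by
    have : (fun ω => (X ω - m) ^ 2) = fun ω => X ω ^ 2 - 2 * m * X ω + m ^ 2 := by
      funext ω; ring
    rw [this]
    exact (hX2i.sub (hXi.const_mul _)).add (integrable_const _)
  have hvar : ∫ ω, (X ω - m) ^ 2 ∂μ ≤ v := by
    have : (fun ω => (X ω - m) ^ 2) = fun ω => X ω ^ 2 - 2 * m * X ω + m ^ 2 := by
      funext ω; ring
    have h1 : ∫ ω, (X ω ^ 2 - 2 * m * X ω + m ^ 2) ∂μ
        = ∫ ω, (X ω ^ 2 - 2 * m * X ω) ∂μ + ∫ _, m ^ 2 ∂μ :=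
      integral_add (hX2i.sub (hXi.const_mul _)) (integrable_const _)
    rw [this, h1, integral_sub hX2i (hXi.const_mul _), integral_const_mul, hEX]
    simp
    nlinarith
  have hmarkov := mul_meas_ge_le_integral_of_nonneg (μ := μ)
    (f := fun ω => (X ω - m) ^ 2) (Eventually.of_forall fun ω => sq_nonneg _) hi3 ((m / 2) ^ 2)
  have hset : {ω | m / 2 ≤ |X ω - m|} = {ω | (m / 2) ^ 2 ≤ (X ω - m) ^ 2} := by
    ext ω
    simp only [Set.mem_ofPred_eq]
    rw [← sq_abs (X ω - m)]
    exact (pow_le_pow_iff_left₀ (by positivity) (abs_nonneg _) two_ne_zero).symm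
  rw [hset, le_div_iff₀ (by positivity)]
  nlinarith [hmarkov.trans hvar]

/-! ### Probabilities of edge patterns and of common colors -/

/-- With finiteness this makes every set of graphs measurable, which is what `.of_discrete` uses
below. -/
instance SimpleGraph.instMeasurableSingletonClass {V : Type*} [Finite V] :
    MeasurableSingletonClass (SimpleGraph V) where
  measurableSet_singleton G := by
    have : ({G} : Set (SimpleGraph V)) = SimpleGraph.edgeSet ⁻¹' {G.edgeSet} := by ext H; simp
    rw [this]
    exact SimpleGraph.measurable_edgeSet (measurableSet_singleton _)

theorem binomialRandom_real_subset_disjoint {V : Type*} [Fintype V] (p : unitInterval)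
    (A B : Finset (Sym2 V)) (hAB : Disjoint A B) (hA : ∀ e ∈ A, ¬ e.IsDiag)
    (hB : ∀ e ∈ B, ¬ e.IsDiag) :
    (SimpleGraph.binomialRandom V p).real
        {G | (∀ e ∈ A, e ∈ G.edgeSet) ∧ ∀ e ∈ B, e ∉ G.edgeSet}
      = (p : ℝ) ^ A.card * (1 - p : ℝ) ^ B.card := by
  classical
  have hms : MeasurableSet {G : SimpleGraph V | (∀ e ∈ A, e ∈ G.edgeSet) ∧ ∀ e ∈ B, e ∉ G.edgeSet} :=
    MeasurableSet.of_discrete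
  -- In terms of independent coin flips the event is a box: each coordinate in `A ∪ B` is
  -- prescribed, true exactly on `A`. Loops are excluded because `fromEdgeSet` discards them.
  have hpre : (fun f : Sym2 V → Prop => {e | f e}) ⁻¹' (SimpleGraph.fromEdgeSet ⁻¹'
      {G : SimpleGraph V | (∀ e ∈ A, e ∈ G.edgeSet) ∧ ∀ e ∈ B, e ∉ G.edgeSet})
      = Set.pi (A ∪ B : Finset _) (fun e => {x : Prop | x ↔ e ∈ A}) := by
    ext f
    simp only [Set.mem_preimage, Set.mem_ofPred_eq, SimpleGraph.edgeSet_fromEdgeSet, Set.mem_pi,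
      Finset.mem_coe, Finset.mem_union, Set.mem_sdiff, Sym2.mem_diagSet]
    constructor
    · rintro ⟨h1, h2⟩ e he
      by_cases heA : e ∈ A
      · simp [heA, (h1 e heA).1]
      · have heB := he.resolve_left heA
        have := h2 e heB
        have hd := hB e heB
        tauto
    · intro h
      refine ⟨fun e he => ⟨(h e (Or.inl he)).2 he, hA e he⟩, fun e he h' => ?_⟩
      exact Finset.disjoint_left.1 hAB ((h e (Or.inr he)).1 h'.1) he
  rw [measureReal_def, SimpleGraph.binomialRandom_eq_map,
    Measure.map_apply SimpleGraph.measurable_fromEdgeSet hms,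
    ProbabilityTheory.setBernoulli_eq_map, Measure.map_apply (by fun_prop) .of_discrete, hpre,
    Measure.infinitePi_pi _ (fun _ _ => .of_discrete), Finset.prod_union hAB]
  rw [Finset.prod_congr rfl (g := fun _ => ((unitInterval.toNNReal p : ℝ≥0∞)))
    fun e he => ?_, Finset.prod_congr (s₁ := B) rfl
    (g := fun _ => ((unitInterval.toNNReal (unitInterval.symm p) : ℝ≥0∞))) fun e he => ?_]
  · simp
  · have : e ∉ A := fun h => Finset.disjoint_left.1 hAB h he
    have hd := hB e he
    simp [this, hd]
  · have hd := hA e he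
    simp [he, hd]

/-- The endpoints of `e` have an available color in common. -/
def ShareColor {V : Type*} {c : ℕ} (S : V → StrategySet c) (e : Sym2 V) : Prop :=
  ∃ a, ∀ i ∈ e, a ∈ (S i).1

/-- The probability that two independent samples of `F` intersect. -/
noncomputable def commonColorProb {c : ℕ} (F : Measure (StrategySet c)) : ℝ :=
  (F.prod F).real {A | (A.1.1 ∩ A.2.1).Nonempty}

theorem iIndepFun_eval_pi {V α : Type*} [Fintype V] [MeasurableSpace α] (F : Measure α)
    [IsProbabilityMeasure F] :
    ProbabilityTheory.iIndepFun (fun i (S : V → α) => S i) (Measure.pi fun _ : V => F) :=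
  ProbabilityTheory.iIndepFun_pi (X := fun _ => id) fun _ => aemeasurable_id

theorem pi_real_shareColor {V : Type*} [Fintype V] {c : ℕ} (F : Measure (StrategySet c))
    [IsProbabilityMeasure F] {e : Sym2 V} (he : ¬ e.IsDiag) :
    (Measure.pi fun _ : V => F).real {S | ShareColor S e} = commonColorProb F := by
  induction e using Sym2.ind with
  | _ i j =>
  have hij : i ≠ j := by simpa using he
  have hind := (iIndepFun_eval_pi (V := V) F).indepFun hij
  rw [ProbabilityTheory.indepFun_iff_map_prod_eq_prod_map_map
    (measurable_pi_apply i).aemeasurable (measurable_pi_apply j).aemeasurable] at hind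
  have hmap : ∀ i : V, (Measure.pi fun _ : V => F).map (fun S => S i) = F := fun i =>
    (measurePreserving_eval (fun _ : V => F) i).map_eq
  rw [hmap, hmap] at hind
  rw [commonColorProb, ← hind, map_measureReal_apply (by fun_prop) .of_discrete]
  congr 1
  ext S
  simp [ShareColor, Finset.Nonempty]

/-- Node-disjoint pairs depend on disjoint coordinates of `S`, hence are independent. Pairs with a
common node may be correlated. -/
theorem pi_real_shareColor_inter {V : Type*} [Fintype V] {c : ℕ} (F : Measure (StrategySet c))
    [IsProbabilityMeasure F] {e f : Sym2 V} (he : ¬ e.IsDiag) (hf : ¬ f.IsDiag)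
    (hef : ∀ i ∈ e, i ∉ f) :
    (Measure.pi fun _ : V => F).real ({S | ShareColor S e} ∩ {S | ShareColor S f})
      = commonColorProb F * commonColorProb F := by
  classical
  have hdisj : Disjoint e.toFinset f.toFinset := by
    rw [Finset.disjoint_left]; simpa using hef
  have hind := (iIndepFun_eval_pi (V := V) F).indepFun_finset _ _ hdisj
    (fun i => measurable_pi_apply i)
  have hpre : ∀ e : Sym2 V, (fun (S : V → StrategySet c) (i : e.toFinset) => S i) ⁻¹'
      {S | ∃ a, ∀ i, a ∈ (S i).1} = {S | ShareColor S e} := fun e => by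
    ext S; simp [ShareColor]
  have := congrArg ENNReal.toReal (hind.measure_inter_preimage_eq_mul
    {S : e.toFinset → StrategySet c | ∃ a, ∀ i, a ∈ (S i).1}
    {S : f.toFinset → StrategySet c | ∃ a, ∀ i, a ∈ (S i).1} .of_discrete .of_discrete)
  rw [ENNReal.toReal_mul, hpre, hpre] at this
  refine this.trans ?_
  congr 1
  · exact pi_real_shareColor F he
  · exact pi_real_shareColor F hf

/-! ### Deterministic welfare bounds -/

namespace ClusteringGame

variable {V : Type*} {c : ℕ} {G : SimpleGraph V} {S : V → StrategySet c}
  {Γ : ClusteringGame V c}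

open Classical in
theorem utility_eq_of_mem_unitCoordinationGames [Fintype V] (hΓ : Γ ∈ unitCoordinationGames G S)
    {s : V → Fin c} {i : V} (hs : s i ∈ (S i).1) :
    Γ.utility s i = (Finset.card {j | G.Adj i j ∧ s i = s j} : ℝ) / 2 := by
  obtain ⟨hanti, hG, hS, hsplit, hw, hpref⟩ := hΓ
  have hcoord : Γ.coord = G := by
    rw [← hG, graph, show Γ.anti = ⊥ from hanti, sup_bot_eq]
  have hp : Γ.pref i (s i) = 0 := hpref i _ (by rw [hS]; exact hs)
  have ha : Γ.anti = ⊥ := hanti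
  rw [utility, hp, hcoord, ha]
  simp only [SimpleGraph.bot_adj, false_and, Finset.filter_false, Finset.sum_empty, zero_add,
    add_zero]
  rw [Finset.sum_congr rfl (g := fun _ => (1 / 2 : ℝ)) ?_, Finset.sum_const, nsmul_eq_mul]
  · ring
  · intro j hj
    have hadj : G.Adj i j := by simp at hj; exact hj.1
    have hadj' : Γ.graph.Adj i j := by rw [hG]; exact hadj
    have h1 := Γ.split_add_pos i j hadj'
    rw [share, hw _ hadj', ← hsplit i j hadj', mul_one]
    rw [← hsplit i j hadj'] at h1
    have h2 : Γ.split i j ≠ 0 := by linarith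
    field_simp
    norm_num

open Classical in
-- Each satisfied edge pays 1/2 to both ends, so by the handshake lemma for the subgraph `H` of
-- satisfied edges the welfare is their number; the color of such an edge is available at both ends.
theorem welfare_le_card_shareColor [Fintype V] (hΓ : Γ ∈ unitCoordinationGames G S)
    {t : V → Fin c} (ht : t ∈ Γ.profiles) :
    Γ.welfare t ≤ Finset.card {e : Sym2 V | e ∈ G.edgeSet ∧ ShareColor S e} := by
  have hS : Γ.strat = S := hΓ.2.2.1
  have ht' : ∀ i, t i ∈ (S i).1 := fun i => hS ▸ ht i
  let H : SimpleGraph V :=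
    { Adj := fun i j => G.Adj i j ∧ t i = t j
      symm := ⟨fun i j h => ⟨h.1.symm, h.2.symm⟩⟩
      loopless := ⟨fun i h => G.loopless.irrefl i h.1⟩ }
  have hdeg : ∀ i, Finset.card {j | G.Adj i j ∧ t i = t j} = H.degree i := fun i => by
    rw [← SimpleGraph.card_neighborFinset_eq_degree]
    congr 1
    ext j
    simp [H]
  have hsum := H.sum_degrees_eq_twice_card_edges
  have hsub : H.edgeFinset ⊆ ({e : Sym2 V | e ∈ G.edgeSet ∧ ShareColor S e} : Finset _) := by
    intro e
    induction e using Sym2.ind with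
    | _ i j =>
    intro h
    have h' : G.Adj i j ∧ t i = t j := by simpa [H] using h
    simp only [Finset.mem_filter, Finset.mem_univ, true_and, SimpleGraph.mem_edgeSet]
    refine ⟨h'.1, t i, fun x hx => ?_⟩
    rcases Sym2.mem_iff.1 hx with rfl | rfl
    · exact ht' _
    · rw [h'.2]; exact ht' _
  have hle : (H.edgeFinset.card : ℝ) ≤ _ := Nat.cast_le.2 (Finset.card_le_card hsub)
  refine le_trans (le_of_eq ?_) hle
  rw [welfare, Finset.sum_congr rfl fun i _ => utility_eq_of_mem_unitCoordinationGames hΓ (ht' i),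
    ← Finset.sum_div]
  simp only [hdeg]
  rw [← Nat.cast_sum, hsum]
  push_cast
  ring

/-- The edges of `G` that meet no other edge of `G`. -/
def _root_.SimpleGraph.isolatedEdgeSet (G : SimpleGraph V) : Set (Sym2 V) :=
  {e | e ∈ G.edgeSet ∧ ∀ f ∈ G.edgeSet, ∀ i ∈ e, i ∈ f → f = e}

open Classical in
theorem card_isolated_le_welfare [Fintype V] (hΓ : Γ ∈ unitCoordinationGames G S) {ε : ℝ}
    (hε : 0 ≤ ε) {k : ℕ} (hk : 2 ≤ k) {s : V → Fin c} (hs : Γ.IsEquilibrium ε k s) :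
    (Finset.card {e : Sym2 V | e ∈ G.isolatedEdgeSet ∧ ShareColor S e} : ℝ)
      ≤ 2 * ε * Γ.welfare s := by
  have hS : Γ.strat = S := hΓ.2.2.1
  have hs' : ∀ i, s i ∈ (S i).1 := fun i => hS ▸ hs.1 i
  set I : Finset (Sym2 V) := {e : Sym2 V | e ∈ G.isolatedEdgeSet ∧ ShareColor S e} with hI
  -- The implication sits under the existential so that `choose` yields a function on all pairs.
  have hex : ∀ e, ∃ j, e ∈ I → j ∈ e ∧ 1 / 2 ≤ ε * Γ.utility s j := by
    intro e
    by_cases he : e ∉ I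
    · exact ⟨e.out.1, fun h => absurd h he⟩
    rw [not_not] at he
    rw [hI, Finset.mem_filter] at he
    obtain ⟨-, ⟨hadj, -⟩, a, ha⟩ := he
    induction e using Sym2.ind with
    | _ x y =>
    rw [SimpleGraph.mem_edgeSet] at hadj
    have hx : a ∈ (S x).1 := ha x (by simp)
    have hy : a ∈ (S y).1 := ha y (by simp)
    obtain ⟨j, hj, hle⟩ := hs.2 {x, y} (by simp) (Finset.card_le_two.trans hk) (fun _ => a)
      (by rw [hS]; simp [hx, hy])
    refine ⟨j, fun _ => ⟨by simpa using hj, le_trans ?_ hle⟩⟩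
    have hval : ∀ z ∈ ({x, y} : Finset V),
        ({x, y} : Finset V).piecewise (fun _ => a) s z = a := fun z hz => by
      rw [Finset.piecewise_eq_of_mem _ _ _ hz]
    have hjS : a ∈ (S j).1 := ha j (by simpa using hj)
    rw [utility_eq_of_mem_unitCoordinationGames hΓ (by rw [hval j hj]; exact hjS)]
    have hcard : 0 < Finset.card {z | G.Adj j z ∧
        ({x, y} : Finset V).piecewise (fun _ => a) s j
          = ({x, y} : Finset V).piecewise (fun _ => a) s z} := by
      rw [Finset.card_pos]
      rw [Finset.mem_insert, Finset.mem_singleton] at hj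
      rcases hj with rfl | rfl
      · exact ⟨y, by simp [hadj]⟩
      · exact ⟨x, by simp [hadj.symm]⟩
    have : (1 : ℝ) ≤ Finset.card {z | G.Adj j z ∧
        ({x, y} : Finset V).piecewise (fun _ => a) s j
          = ({x, y} : Finset V).piecewise (fun _ => a) s z} := by exact_mod_cast hcard
    linarith
  choose g hg using hex
  -- Isolated edges are pairwise disjoint, so no player is charged twice.
  have hinj : Set.InjOn g (I : Set (Sym2 V)) := by
    intro e he f hf hef
    have he' : e ∈ I := he
    have hf' : f ∈ I := hf
    have hge := (hg e he').1
    have hgf := (hg f hf').1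
    rw [hI, Finset.mem_filter] at he' hf'
    exact hf'.2.1.2 e he'.2.1.1 (g f) hgf (hef ▸ hge)
  have hnonneg : ∀ i, 0 ≤ Γ.utility s i := fun i => by
    rw [utility_eq_of_mem_unitCoordinationGames hΓ (hs' i)]; positivity
  have h1 : ∑ e ∈ I, Γ.utility s (g e) ≤ Γ.welfare s := by
    rw [← Finset.sum_image hinj]
    exact Finset.sum_le_univ_sum_of_nonneg hnonneg
  have h2 : ∑ _e ∈ I, (1 / 2 : ℝ) ≤ ∑ e ∈ I, ε * Γ.utility s (g e) := 
    Finset.sum_le_sum fun e he => (hg e he).2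
  rw [← Finset.mul_sum, Finset.sum_const, nsmul_eq_mul] at h2
  nlinarith [mul_le_mul_of_nonneg_left h1 hε]

open Classical in
-- The comparison is made in product form, which also covers equilibria of welfare zero: then the
-- optimum vanishes too and the quotient is 0.
theorem classPoA_unitCoordinationGames_le [Fintype V] (G : SimpleGraph V) (S : V → StrategySet c)
    {ε : ℝ} (hε : 0 ≤ ε) {k : ℕ} (hk : 2 ≤ k) {r : ℝ≥0}
    (h : (Finset.card {e : Sym2 V | e ∈ G.edgeSet ∧ ShareColor S e} : ℝ)
      ≤ r * Finset.card {e : Sym2 V | e ∈ G.isolatedEdgeSet ∧ ShareColor S e}) :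
    classPoA (unitCoordinationGames G S) ε k ≤ (r * (2 * ε.toNNReal) : ℝ≥0) := by
  refine iSup₂_le fun Γ hΓ => iSup₂_le fun s hs => ENNReal.div_le_of_le_mul ?_
  refine iSup₂_le fun t ht => ?_
  rw [← ENNReal.ofReal_coe_nnreal, ← ENNReal.ofReal_mul (by positivity)]
  refine ENNReal.ofReal_le_ofReal ((welfare_le_card_shareColor hΓ ht).trans (h.trans ?_))
  push_cast
  rw [Real.coe_toNNReal _ hε]
  have := mul_le_mul_of_nonneg_left (card_isolated_le_welfare hΓ hε hk hs) r.2
  calc _ ≤ _ := this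
    _ = _ := by simp; ring

end ClusteringGame

/-! ### First and second moments of single edges and pairs -/

section Moments

variable {V : Type*} {c : ℕ}

/-- `e` is an edge of the random graph and its endpoints have a common color. -/
def edgeShareEvent (c : ℕ) (e : Sym2 V) : Set (SimpleGraph V × (V → StrategySet c)) :=
  {G | e ∈ G.edgeSet} ×ˢ {S | ShareColor S e}

/-- `e` is an isolated edge of the random graph and its endpoints have a common color. -/
def isolatedShareEvent (c : ℕ) (e : Sym2 V) : Set (SimpleGraph V × (V → StrategySet c)) :=
  {G | e ∈ G.isolatedEdgeSet} ×ˢ {S | ShareColor S e}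

variable [Fintype V]

open Classical in
/-- The pairs of nodes other than `e` that meet `e`. -/
noncomputable def incidentPairs (e : Sym2 V) : Finset (Sym2 V) :=
  {f | ¬ f.IsDiag ∧ f ≠ e ∧ ∃ i ∈ e, i ∈ f}

theorem mem_incidentPairs {e f : Sym2 V} :
    f ∈ incidentPairs e ↔ ¬ f.IsDiag ∧ f ≠ e ∧ ∃ i ∈ e, i ∈ f := by
  simp [incidentPairs]

theorem card_incidentPairs_le (e : Sym2 V) : (incidentPairs e).card ≤ 2 * Fintype.card V := by
  classical
  induction e using Sym2.ind with
  | _ x y =>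
  have hsub : incidentPairs s(x, y)
      ⊆ (({x, y} : Finset V) ×ˢ (Finset.univ : Finset V)).image fun z => s(z.1, z.2) := by
    intro f hf
    obtain ⟨-, -, i, hi, hif⟩ := mem_incidentPairs.1 hf
    obtain ⟨j, rfl⟩ := hif
    exact Finset.mem_image.2 ⟨(i, j), by simpa using hi, rfl⟩
  refine (Finset.card_le_card hsub).trans (Finset.card_image_le.trans ?_)
  rw [Finset.card_product, Finset.card_univ]
  exact Nat.mul_le_mul_right _ Finset.card_le_two

/-- A pair meeting both must join one of two endpoints of `e` to one of two endpoints of `f`. -/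
theorem card_incidentPairs_inter_le [DecidableEq V] {e f : Sym2 V} (hef : ∀ i ∈ e, i ∉ f) :
    (incidentPairs e ∩ incidentPairs f).card ≤ 4 := by
  induction e using Sym2.ind with
  | _ x y =>
  induction f using Sym2.ind with
  | _ z w =>
  have hsub : incidentPairs s(x, y) ∩ incidentPairs s(z, w)
      ⊆ (({x, y} : Finset V) ×ˢ ({z, w} : Finset V)).image fun z => s(z.1, z.2) := by
    intro g hg
    rw [Finset.mem_inter] at hg
    obtain ⟨-, -, i, hi, hig⟩ := mem_incidentPairs.1 hg.1
    obtain ⟨-, -, j, hj, hjg⟩ := mem_incidentPairs.1 hg.2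
    have hij : i ≠ j := fun h => hef i hi (h ▸ hj)
    have : g = s(i, j) := (Sym2.mem_and_mem_iff hij).1 ⟨hig, hjg⟩
    exact Finset.mem_image.2 ⟨(i, j), by simpa using ⟨by simpa using hi, by simpa using hj⟩,
      this.symm⟩
  refine (Finset.card_le_card hsub).trans (Finset.card_image_le.trans ?_)
  rw [Finset.card_product]
  exact Nat.mul_le_mul Finset.card_le_two Finset.card_le_two

/-- This writes isolation as a pattern of present and absent edges, whose probability is a product.
-/
theorem mem_isolatedEdgeSet_iff {G : SimpleGraph V} {e : Sym2 V} :
    e ∈ G.isolatedEdgeSet ↔ e ∈ G.edgeSet ∧ ∀ f ∈ incidentPairs e, f ∉ G.edgeSet := by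
  refine and_congr_right fun _ => ⟨fun h f hf hfG => ?_, fun h f hf i hi hif => ?_⟩
  · obtain ⟨-, hne, i, hi, hif⟩ := mem_incidentPairs.1 hf
    exact hne (h f hfG i hi hif)
  · by_contra hne
    exact h f (mem_incidentPairs.2 ⟨G.not_isDiag_of_mem_edgeSet hf, hne, i, hi, hif⟩) hf

variable (q : unitInterval) (F : Measure (StrategySet c)) [IsProbabilityMeasure F]

theorem real_edgeShareEvent {e : Sym2 V} (he : ¬ e.IsDiag) :
    ((SimpleGraph.binomialRandom V q).prod (Measure.pi fun _ => F)).real (edgeShareEvent c e)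
      = q * commonColorProb F := by
  rw [edgeShareEvent, measureReal_prod_prod, pi_real_shareColor F he]
  have := binomialRandom_real_subset_disjoint q {e} ∅ (by simp) (by simpa using he) (by simp)
  simp at this
  rw [this]

theorem real_isolatedShareEvent {e : Sym2 V} (he : ¬ e.IsDiag) :
    ((SimpleGraph.binomialRandom V q).prod (Measure.pi fun _ => F)).real (isolatedShareEvent c e)
      = q * (1 - q : ℝ) ^ (incidentPairs e).card * commonColorProb F := by
  rw [isolatedShareEvent, measureReal_prod_prod, pi_real_shareColor F he]
  have := binomialRandom_real_subset_disjoint q {e} (incidentPairs e)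
    (by simp [mem_incidentPairs]) (by simpa using he) (fun f hf => (mem_incidentPairs.1 hf).1)
  simp only [Finset.mem_singleton, forall_eq, Finset.card_singleton, pow_one] at this
  simp only [mem_isolatedEdgeSet_iff, this]

theorem real_edgeShareEvent_inter {e f : Sym2 V} (he : ¬ e.IsDiag) (hf : ¬ f.IsDiag)
    (hef : ∀ i ∈ e, i ∉ f) :
    ((SimpleGraph.binomialRandom V q).prod (Measure.pi fun _ => F)).real
        (edgeShareEvent c e ∩ edgeShareEvent c f)
      = (q * commonColorProb F) * (q * commonColorProb F) := by
  classical
  have hne : e ≠ f := by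
    rintro rfl
    exact hef _ (Sym2.out_fst_mem e) (Sym2.out_fst_mem e)
  rw [edgeShareEvent, edgeShareEvent, Set.prod_inter_prod, measureReal_prod_prod,
    pi_real_shareColor_inter F he hf hef]
  have := binomialRandom_real_subset_disjoint q {e, f} ∅ (by simp) (by simp [he, hf]) (by simp)
  simp [hne] at this
  rw [← Set.ofPred_and, this]
  ring

theorem real_edgeShareEvent_inter_le {e f : Sym2 V} (he : ¬ e.IsDiag) (hf : ¬ f.IsDiag)
    (hne : e ≠ f) :
    ((SimpleGraph.binomialRandom V q).prod (Measure.pi fun _ => F)).real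
        (edgeShareEvent c e ∩ edgeShareEvent c f) ≤ (q : ℝ) ^ 2 := by
  classical
  rw [edgeShareEvent, edgeShareEvent, Set.prod_inter_prod, measureReal_prod_prod]
  have := binomialRandom_real_subset_disjoint q {e, f} ∅ (by simp) (by simp [he, hf]) (by simp)
  simp [hne] at this
  rw [← Set.ofPred_and, this]
  exact mul_le_of_le_one_right (by positivity) measureReal_le_one

/-- For disjoint pairs the only dependence comes from the at most 4 pairs that must be absent for
both; they are counted once instead of twice, hence the exponent 4. The factor stays on the left so
that q = 1 is allowed. -/
theorem real_isolatedShareEvent_inter_mul_le {e f : Sym2 V} (he : ¬ e.IsDiag) (hf : ¬ f.IsDiag)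
    (hne : e ≠ f) :
    ((SimpleGraph.binomialRandom V q).prod (Measure.pi fun _ => F)).real
        (isolatedShareEvent c e ∩ isolatedShareEvent c f) * (1 - q : ℝ) ^ 4
      ≤ (q * (1 - q : ℝ) ^ (incidentPairs e).card * commonColorProb F)
        * (q * (1 - q : ℝ) ^ (incidentPairs f).card * commonColorProb F) := by
  classical
  have hq0 : (0 : ℝ) ≤ q := q.2.1
  have hq1 : (0 : ℝ) ≤ 1 - q := sub_nonneg.2 q.2.2
  have hp : 0 ≤ commonColorProb F := measureReal_nonneg
  by_cases hef : ∀ i ∈ e, i ∉ f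
  · rw [isolatedShareEvent, isolatedShareEvent, Set.prod_inter_prod, measureReal_prod_prod,
      pi_real_shareColor_inter F he hf hef]
    have hset : {G : SimpleGraph V | e ∈ G.isolatedEdgeSet} ∩ {G | f ∈ G.isolatedEdgeSet}
        = {G | (∀ g ∈ ({e, f} : Finset (Sym2 V)), g ∈ G.edgeSet) ∧
            ∀ g ∈ incidentPairs e ∪ incidentPairs f, g ∉ G.edgeSet} := by
      ext G
      simp only [Set.mem_inter_iff, Set.mem_ofPred_eq, mem_isolatedEdgeSet_iff, Finset.mem_insert,
        Finset.mem_singleton, Finset.mem_union, forall_eq, or_imp, forall_and]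
      tauto
    have hdisj : Disjoint ({e, f} : Finset (Sym2 V)) (incidentPairs e ∪ incidentPairs f) := by
      rw [Finset.disjoint_left]
      simp only [Finset.mem_insert, Finset.mem_singleton, Finset.mem_union, mem_incidentPairs]
      rintro g (rfl | rfl)
      · rintro (⟨-, h, -⟩ | ⟨-, -, i, hi, hi'⟩)
        exacts [h rfl, hef i hi' hi]
      · rintro (⟨-, -, i, hi, hi'⟩ | ⟨-, h, -⟩)
        exacts [hef i hi hi', h rfl]
    rw [hset, binomialRandom_real_subset_disjoint q _ _ hdisj (by simp [he, hf])
      (fun g hg => by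
        rcases Finset.mem_union.1 hg with h | h <;> exact (mem_incidentPairs.1 h).1),
      Finset.card_pair hne]
    have hcard := Finset.card_union_add_card_inter (incidentPairs e) (incidentPairs f)
    have hle := card_incidentPairs_inter_le hef
    have hpow : (1 - q : ℝ) ^ (incidentPairs e ∪ incidentPairs f).card * (1 - q : ℝ) ^ 4
        ≤ (1 - q : ℝ) ^ (incidentPairs e).card * (1 - q : ℝ) ^ (incidentPairs f).card := by
      rw [← pow_add, ← pow_add]
      exact pow_le_pow_of_le_one hq1 (by linarith) (by omega)
    calc _ = (q : ℝ) ^ 2 * (commonColorProb F * commonColorProb F) *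
          ((1 - q : ℝ) ^ (incidentPairs e ∪ incidentPairs f).card * (1 - q : ℝ) ^ 4) := by ring
      _ ≤ (q : ℝ) ^ 2 * (commonColorProb F * commonColorProb F) *
          ((1 - q : ℝ) ^ (incidentPairs e).card * (1 - q : ℝ) ^ (incidentPairs f).card) :=
        mul_le_mul_of_nonneg_left hpow (by positivity)
      _ = _ := by ring
  -- Two distinct edges with a common node cannot both be isolated.
  · push Not at hef
    obtain ⟨i, hie, hif⟩ := hef
    have hempty : isolatedShareEvent c e ∩ isolatedShareEvent c f = ∅ := by
      rw [Set.eq_empty_iff_forall_notMem]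
      rintro ω ⟨⟨h1, -⟩, ⟨h2, -⟩⟩
      exact hne (h1.2 f h2.1 i hie hif).symm
    rw [hempty, measureReal_empty, zero_mul]
    positivity

end Moments

/-! ### Variance bounds and comparison of the two counts -/

section Concentration

variable {V : Type*} {c : ℕ} [Fintype V]

open Classical in
theorem sum_indicator_edgeShareEvent (ω : SimpleGraph V × (V → StrategySet c)) :
    ∑ e ∈ (⊤ : SimpleGraph V).edgeFinset, (edgeShareEvent c e).indicator (fun _ => (1 : ℝ)) ω
      = Finset.card {e : Sym2 V | e ∈ ω.1.edgeSet ∧ ShareColor ω.2 e} := by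
  simp only [Set.indicator_apply, Finset.sum_boole]
  congr 2
  ext e
  simp only [Finset.mem_filter, edgeShareEvent, Set.mem_prod, Set.mem_ofPred_eq, Finset.mem_univ,
    true_and, SimpleGraph.mem_edgeFinset, and_iff_right_iff_imp]
  exact fun h => SimpleGraph.edgeSet_mono le_top h.1

open Classical in
theorem sum_indicator_isolatedShareEvent (ω : SimpleGraph V × (V → StrategySet c)) :
    ∑ e ∈ (⊤ : SimpleGraph V).edgeFinset, (isolatedShareEvent c e).indicator (fun _ => (1 : ℝ)) ω
      = Finset.card {e : Sym2 V | e ∈ ω.1.isolatedEdgeSet ∧ ShareColor ω.2 e} := by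
  simp only [Set.indicator_apply, Finset.sum_boole]
  congr 2
  ext e
  simp only [Finset.mem_filter, isolatedShareEvent, Set.mem_prod, Set.mem_ofPred_eq,
    Finset.mem_univ, true_and, SimpleGraph.mem_edgeFinset, and_iff_right_iff_imp]
  exact fun h => SimpleGraph.edgeSet_mono le_top h.1.1

variable (q : unitInterval) (F : Measure (StrategySet c)) [IsProbabilityMeasure F]

open Classical in
-- Disjoint pairs are independent and give the squared mean, the diagonal gives the mean, and each
-- edge meets at most 2|V| others, each contributing at most q².
theorem sum_real_edgeShareEvent_inter_le :
    ∑ e ∈ (⊤ : SimpleGraph V).edgeFinset, ∑ f ∈ (⊤ : SimpleGraph V).edgeFinset,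
      ((SimpleGraph.binomialRandom V q).prod (Measure.pi fun _ => F)).real
        (edgeShareEvent c e ∩ edgeShareEvent c f)
      ≤ ((Fintype.card V).choose 2 * (q * commonColorProb F)) ^ 2
        + ((Fintype.card V).choose 2 * (q * commonColorProb F)
          + (Fintype.card V).choose 2 * (2 * Fintype.card V * (q : ℝ) ^ 2)) := by
  set E := (⊤ : SimpleGraph V).edgeFinset with hE
  have hdiag : ∀ e ∈ E, ¬ e.IsDiag := fun e he =>
    SimpleGraph.not_isDiag_of_mem_edgeFinset he
  have hq0 : (0 : ℝ) ≤ q := q.2.1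
  have hp : 0 ≤ commonColorProb F := measureReal_nonneg
  have hC : E.card = (Fintype.card V).choose 2 := SimpleGraph.card_edgeFinset_top_eq_card_choose_two
  set P := q * commonColorProb F with hP
  have hP0 : 0 ≤ P := mul_nonneg hq0 hp
  have hpair : ∀ e ∈ E, ∀ f ∈ E,
      ((SimpleGraph.binomialRandom V q).prod (Measure.pi fun _ => F)).real
        (edgeShareEvent c e ∩ edgeShareEvent c f)
      ≤ P * P + (if f = e then P else 0) + (if f ∈ incidentPairs e then (q : ℝ) ^ 2 else 0) := by
    intro e he f hf
    by_cases hfe : f = e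
    · subst hfe
      rw [Set.inter_self, real_edgeShareEvent q F (hdiag f hf), if_pos rfl]
      have : 0 ≤ (if f ∈ incidentPairs f then (q : ℝ) ^ 2 else 0) := by positivity
      nlinarith
    rw [if_neg hfe]
    by_cases hinc : f ∈ incidentPairs e
    · rw [if_pos hinc]
      have := real_edgeShareEvent_inter_le q F (hdiag e he) (hdiag f hf) (Ne.symm hfe)
      nlinarith
    · rw [real_edgeShareEvent_inter q F (hdiag e he) (hdiag f hf) fun i hi hif =>
        hinc (mem_incidentPairs.2 ⟨hdiag f hf, hfe, i, hi, hif⟩), if_neg hinc]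
      simp [hP]
  have hrow : ∀ e ∈ E, ∑ f ∈ E,
      ((SimpleGraph.binomialRandom V q).prod (Measure.pi fun _ => F)).real
        (edgeShareEvent c e ∩ edgeShareEvent c f)
      ≤ E.card * (P * P) + P + 2 * Fintype.card V * (q : ℝ) ^ 2 := by
    intro e he
    refine (Finset.sum_le_sum (hpair e he)).trans ?_
    rw [Finset.sum_add_distrib, Finset.sum_add_distrib, Finset.sum_ite_eq' E e, if_pos he,
      Finset.sum_const, nsmul_eq_mul, ← Finset.sum_filter, Finset.sum_const, nsmul_eq_mul]
    have h1 : (E.filter (· ∈ incidentPairs e)).card ≤ 2 * Fintype.card V :=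
      (Finset.card_le_card fun f hf => (Finset.mem_filter.1 hf).2).trans (card_incidentPairs_le e)
    have h2 : ((E.filter (· ∈ incidentPairs e)).card : ℝ) ≤ 2 * Fintype.card V := by
      exact_mod_cast h1
    gcongr
  refine (Finset.sum_le_sum hrow).trans (le_of_eq ?_)
  rw [Finset.sum_const, nsmul_eq_mul, hC]
  ring

open Classical in
theorem sum_real_isolatedShareEvent_inter_le (hq : (q : ℝ) < 1) {m : ℝ}
    (hm : m = ∑ e ∈ (⊤ : SimpleGraph V).edgeFinset,
      ((SimpleGraph.binomialRandom V q).prod (Measure.pi fun _ => F)).real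
        (isolatedShareEvent c e)) :
    ∑ e ∈ (⊤ : SimpleGraph V).edgeFinset, ∑ f ∈ (⊤ : SimpleGraph V).edgeFinset,
      ((SimpleGraph.binomialRandom V q).prod (Measure.pi fun _ => F)).real
        (isolatedShareEvent c e ∩ isolatedShareEvent c f)
      ≤ m ^ 2 + (m + (((1 - q : ℝ) ^ 4)⁻¹ - 1) * m ^ 2) := by
  set E := (⊤ : SimpleGraph V).edgeFinset with hE
  set μ := (SimpleGraph.binomialRandom V q).prod (Measure.pi fun _ : V => F) with hμ
  have hdiag : ∀ e ∈ E, ¬ e.IsDiag := fun e he =>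
    SimpleGraph.not_isDiag_of_mem_edgeFinset he
  have hq0 : 0 < (1 - q : ℝ) := sub_pos.2 hq
  have hpair : ∀ e ∈ E, ∀ f ∈ E, μ.real (isolatedShareEvent c e ∩ isolatedShareEvent c f)
      ≤ ((1 - q : ℝ) ^ 4)⁻¹ * (μ.real (isolatedShareEvent c e) * μ.real (isolatedShareEvent c f))
        + (if f = e then μ.real (isolatedShareEvent c e) else 0) := by
    intro e he f hf
    by_cases hfe : f = e
    · subst hfe
      rw [Set.inter_self, if_pos rfl]
      have : 0 ≤ ((1 - q : ℝ) ^ 4)⁻¹ *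
        (μ.real (isolatedShareEvent c f) * μ.real (isolatedShareEvent c f)) := by positivity
      linarith
    · rw [if_neg hfe, add_zero, inv_mul_eq_div, le_div_iff₀ (by positivity), hμ,
        real_isolatedShareEvent q F (hdiag e he), real_isolatedShareEvent q F (hdiag f hf)]
      exact real_isolatedShareEvent_inter_mul_le q F (hdiag e he) (hdiag f hf) (Ne.symm hfe)
  refine (Finset.sum_le_sum fun e he => Finset.sum_le_sum (hpair e he)).trans (le_of_eq ?_)
  simp only [Finset.sum_add_distrib, Finset.sum_ite_eq', ← Finset.mul_sum]
  rw [Finset.sum_congr (s₁ := E) rfl fun e he => if_pos he, ← Finset.sum_mul, ← hm]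
  ring

open Classical in
/-- With high probability, the number of edges with a common color is at most a constant times the
number of isolated edges with a common color. -/
theorem real_card_isolated_lt_le (hq0 : 0 < (q : ℝ)) (hq : (q : ℝ) < 1)
    (hV : 2 ≤ Fintype.card V) (hp : 0 < commonColorProb F) {a : ℝ} (ha : 0 < a)
    (haq : a ≤ (1 - q : ℝ) ^ (2 * Fintype.card V)) :
    ((SimpleGraph.binomialRandom V q).prod (Measure.pi fun _ => F)).real
        {ω | ¬ ((Finset.card {e : Sym2 V | e ∈ ω.1.edgeSet ∧ ShareColor ω.2 e} : ℝ)
          ≤ 3 / a * Finset.card {e : Sym2 V | e ∈ ω.1.isolatedEdgeSet ∧ ShareColor ω.2 e})}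
      ≤ 4 / (((Fintype.card V).choose 2 : ℝ) * (q * commonColorProb F))
        + 8 * Fintype.card V / (((Fintype.card V).choose 2 : ℝ) * commonColorProb F ^ 2)
        + 4 / (a * (((Fintype.card V).choose 2 : ℝ) * (q * commonColorProb F)))
        + 4 * (((1 - q : ℝ) ^ 4)⁻¹ - 1) := by
  set E := (⊤ : SimpleGraph V).edgeFinset with hE
  set μ := (SimpleGraph.binomialRandom V q).prod (Measure.pi fun _ : V => F) with hμ
  set p := commonColorProb F with hpdef
  set C : ℝ := ((Fintype.card V).choose 2 : ℝ) with hCdef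
  have hdiag : ∀ e ∈ E, ¬ e.IsDiag := fun e he =>
    SimpleGraph.not_isDiag_of_mem_edgeFinset he
  have hC : (E.card : ℝ) = C := by
    rw [hCdef, hE, SimpleGraph.card_edgeFinset_top_eq_card_choose_two]
  have hC0 : 0 < C := by
    rw [hCdef]; exact_mod_cast Nat.choose_pos hV
  set m : ℝ := C * (q * p) with hmdef
  have hm0 : 0 < m := by positivity
  have hm : m = ∑ e ∈ E, μ.real (edgeShareEvent c e) := by
    rw [Finset.sum_congr rfl fun e he => real_edgeShareEvent q F (hdiag e he), Finset.sum_const,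
      nsmul_eq_mul, hC]
  obtain ⟨m', hm'⟩ : ∃ m', m' = ∑ e ∈ E, μ.real (isolatedShareEvent c e) := ⟨_, rfl⟩
  -- Isolation requires at most 2|V| absent pairs, so it costs at most the factor `a`.
  have hm'le : a * m ≤ m' := by
    rw [hm', hmdef, ← hC, mul_left_comm, ← nsmul_eq_mul]
    refine Finset.card_nsmul_le_sum _ _ _ fun e he => ?_
    rw [hμ, real_isolatedShareEvent q F (hdiag e he)]
    have : a ≤ (1 - q : ℝ) ^ (incidentPairs e).card :=
      haq.trans (pow_le_pow_of_le_one (sub_nonneg.2 q.2.2) (by linarith) (card_incidentPairs_le e))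
    calc a * (q * p) ≤ (1 - q : ℝ) ^ (incidentPairs e).card * (q * p) := by gcongr
      _ = _ := by ring
  have ham : 0 < a * m := by positivity
  have hm'0 : 0 < m' := ham.trans_le hm'le
  have h1 := measureReal_half_le_abs_count_sub μ E (fun e => edgeShareEvent c e)
    (fun _ _ => .of_discrete) hm hm0 (sum_real_edgeShareEvent_inter_le q F)
  have h2 := measureReal_half_le_abs_count_sub μ E (fun e => isolatedShareEvent c e)
    (fun _ _ => .of_discrete) hm' hm'0 (sum_real_isolatedShareEvent_inter_le q F hq hm')
  have hb1 : 4 * (m + C * (2 * Fintype.card V * (q : ℝ) ^ 2)) / m ^ 2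
      = 4 / m + 8 * Fintype.card V / (C * p ^ 2) := by
    rw [hmdef]; field_simp
    ring
  have hb2 : 4 * (m' + (((1 - q : ℝ) ^ 4)⁻¹ - 1) * m' ^ 2) / m' ^ 2
      ≤ 4 / (a * m) + 4 * (((1 - q : ℝ) ^ 4)⁻¹ - 1) := by
    have : 4 * (m' + (((1 - q : ℝ) ^ 4)⁻¹ - 1) * m' ^ 2) / m' ^ 2
      = 4 / m' + 4 * (((1 - q : ℝ) ^ 4)⁻¹ - 1) := by
      generalize ((1 - q : ℝ) ^ 4)⁻¹ = z
      field_simp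
    rw [this]
    gcongr
  simp only [hE, sum_indicator_edgeShareEvent, sum_indicator_isolatedShareEvent] at h1 h2
  rw [hb1] at h1
  refine (measureReal_mono ?_).trans ((measureReal_union_le _ _).trans
    ((add_le_add h1 (h2.trans hb2)).trans (le_of_eq (by ring))))
  -- Off both deviation events N < 3m/2 and M > m'/2 ≥ am/2, which gives N ≤ (3/a) M.
  intro ω hω
  simp only [Set.mem_ofPred_eq, not_le] at hω
  by_contra hcon
  simp only [Set.mem_union, Set.mem_ofPred_eq, not_or, not_le, abs_lt] at hcon
  obtain ⟨⟨-, hN⟩, hM, -⟩ := hcon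
  rw [div_mul_eq_mul_div, div_lt_iff₀ ha] at hω
  nlinarith

end Concentration

/-! ### Asymptotics for edge probability d/n -/

theorem exp_neg_four_mul_le_one_sub_div_pow {d : ℝ} (hd : 0 ≤ d) {n : ℕ} (hn : 0 < n)
    (hdn : 2 * d ≤ n) : Real.exp (-(4 * d)) ≤ (1 - d / n) ^ (2 * n) := by
  have hn' : (0 : ℝ) < n := by exact_mod_cast hn
  set x := d / n with hx
  have hx0 : 0 ≤ x := by positivity
  have hx2 : x ≤ 1 / 2 := by rw [hx, div_le_iff₀ hn']; linarith
  -- From exp(2x) ≥ 1 + 2x and (1 - x)(1 + 2x) = 1 + x(1 - 2x) ≥ 1 for 0 ≤ x ≤ 1/2.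
  have h : Real.exp (-(2 * x)) ≤ 1 - x := by
    rw [Real.exp_neg, inv_le_iff_one_le_mul₀ (Real.exp_pos _)]
    nlinarith [Real.add_one_le_exp (2 * x)]
  calc Real.exp (-(4 * d)) = Real.exp (-(2 * x)) ^ (2 * n) := by
        rw [← Real.exp_nat_mul, hx]
        congr 1
        push_cast
        field_simp
        ring
    _ ≤ _ := pow_le_pow_left₀ (Real.exp_pos _).le h _

open Classical in
theorem tendsto_real_card_isolated_lt {d : ℝ} (hd : 0 < d) {c : ℕ → ℕ}
    {F : (n : ℕ) → Measure (StrategySet (c n))} (hF : ∀ n, IsProbabilityMeasure (F n))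
    (hccp : CommonColorProperty F) :
    Tendsto (fun n : ℕ => (randomInstance d n (F n)).real
      {ω | ¬ ((Finset.card {e : Sym2 (Fin n) | e ∈ ω.1.edgeSet ∧ ShareColor ω.2 e} : ℝ)
        ≤ 3 / Real.exp (-(4 * d)) *
          Finset.card {e : Sym2 (Fin n) | e ∈ ω.1.isolatedEdgeSet ∧ ShareColor ω.2 e})})
      atTop (𝓝 0) := by
  obtain ⟨d₀, hd₀, hp⟩ := hccp
  set a := Real.exp (-(4 * d)) with ha
  have ha0 : 0 < a := Real.exp_pos _
  have hx : Tendsto (fun n : ℕ => (n : ℝ)⁻¹) atTop (𝓝 0) :=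
    tendsto_inv_atTop_nhds_zero_nat
  have hlim : Tendsto (fun n : ℕ => 16 / (d * d₀) * (n : ℝ)⁻¹ + 32 / d₀ ^ 2 * (n : ℝ)⁻¹
      + 16 / (a * (d * d₀)) * (n : ℝ)⁻¹ + 4 * (((1 - d * (n : ℝ)⁻¹) ^ 4)⁻¹ - 1))
      atTop (𝓝 0) := by
    have h4 : Tendsto (fun n : ℕ => ((1 - d * (n : ℝ)⁻¹) ^ 4)⁻¹) atTop
        (𝓝 (((1 - d * 0) ^ 4)⁻¹)) :=
      ((tendsto_const_nhds.sub (hx.const_mul d)).pow 4).inv₀ (by simp)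
    have := (((hx.const_mul (16 / (d * d₀))).add (hx.const_mul (32 / d₀ ^ 2))).add
      (hx.const_mul (16 / (a * (d * d₀))))).add ((h4.sub_const 1).const_mul 4)
    simpa using this
  refine tendsto_of_tendsto_of_tendsto_of_le_of_le' tendsto_const_nhds hlim
    (Eventually.of_forall fun n => measureReal_nonneg) ?_
  -- For n ≥ 2d the cutoff in `edgeProb` is inactive and d/n ≤ 1/2; for n ≥ 2 one has n(n - 1)/2 ≥
  -- n²/4.
  filter_upwards [eventually_ge_atTop 2, eventually_ge_atTop ⌈2 * d⌉₊] with n hn2 hnd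
  have hdn : 2 * d ≤ n := (Nat.le_ceil _).trans (by exact_mod_cast hnd)
  have hn2' : (2 : ℝ) ≤ n := by exact_mod_cast hn2
  have hn0 : (0 : ℝ) < n := by linarith
  have hq : ((edgeProb d n : unitInterval) : ℝ) = d / n := by
    rw [edgeProb, Set.projIcc_of_mem zero_le_one
      (⟨by positivity, by rw [div_le_one hn0]; linarith⟩ : d / n ∈ Set.Icc (0 : ℝ) 1)]
  have hpn : d₀ ≤ commonColorProb (F n) := hp n
  have hC : (n : ℝ) ^ 2 / 4 ≤ (n.choose 2 : ℝ) := by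
    rw [Nat.cast_choose_two]
    nlinarith
  have hmain := real_card_isolated_lt_le (V := Fin n) (edgeProb d n) (F n)
    (by rw [hq]; positivity) (by rw [hq, div_lt_one hn0]; linarith) (by simpa using hn2)
    (hd₀.trans_le hpn) ha0
    (by rw [hq, Fintype.card_fin]
        exact exp_neg_four_mul_le_one_sub_div_pow hd.le (by omega) hdn)
  rw [Fintype.card_fin, hq] at hmain
  refine hmain.trans ?_
  have hm : (n : ℝ) ^ 2 / 4 * (d / n * d₀) ≤ n.choose 2 * (d / n * commonColorProb (F n)) := by
    gcongr
  have hm' : (n : ℝ) ^ 2 / 4 * (d / n * d₀) = n * (d * d₀) / 4 := by field_simp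
  have hpos : 0 < (n : ℝ) * (d * d₀) / 4 := by positivity
  rw [hm'] at hm
  have h1 : 4 / (n.choose 2 * (d / n * commonColorProb (F n))) ≤ 16 / (d * d₀) * (n : ℝ)⁻¹ :=
    calc _ ≤ 4 / (n * (d * d₀) / 4) := by gcongr
      _ = _ := by field_simp; norm_num
  have h2 : 8 * n / (n.choose 2 * commonColorProb (F n) ^ 2) ≤ 32 / d₀ ^ 2 * (n : ℝ)⁻¹ :=
    calc _ ≤ 8 * n / ((n : ℝ) ^ 2 / 4 * d₀ ^ 2) := by gcongr
      _ = _ := by field_simp; norm_num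
  have h3 : 4 / (a * (n.choose 2 * (d / n * commonColorProb (F n))))
      ≤ 16 / (a * (d * d₀)) * (n : ℝ)⁻¹ :=
    calc _ ≤ 4 / (a * (n * (d * d₀) / 4)) := by gcongr
      _ = _ := by field_simp; norm_num
  rw [← div_eq_mul_inv d]
  linarith

theorem theorem14 (d ε : ℝ) (hd : 0 < d) (hε : 1 ≤ ε) :
    ∃ β : ℝ≥0, ∀ k : ℕ, 2 ≤ k →
      ∀ c : ℕ → ℕ, (∀ n, 3 ≤ c n) →
      ∀ F : (n : ℕ) → Measure (StrategySet (c n)), (∀ n, IsProbabilityMeasure (F n)) →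
        CommonColorProperty F →
        Tendsto (fun n : ℕ => randomInstance d n (F n)
            {ω | ClusteringGame.classPoA
              (ClusteringGame.unitCoordinationGames ω.1 ω.2) ε k ≤ (β : ℝ≥0∞)})
          atTop (𝓝 1) := by
  classical
  set r : ℝ≥0 := ⟨3 / Real.exp (-(4 * d)), by positivity⟩ with hr
  refine ⟨r * (2 * ε.toNNReal), fun k hk c _ F hF hccp => ?_⟩
  have hprob : ∀ n, IsProbabilityMeasure (randomInstance d n (F n)) := fun n => by
    rw [randomInstance]; infer_instance
  have hlim := ENNReal.tendsto_ofReal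
    ((tendsto_real_card_isolated_lt hd hF hccp).const_sub (1 : ℝ))
  rw [sub_zero, ENNReal.ofReal_one] at hlim
  -- The probability is squeezed between 1 minus that of the failure event and 1.
  refine tendsto_of_tendsto_of_tendsto_of_le_of_le hlim tendsto_const_nhds (fun n => ?_)
    fun n => prob_le_one
  rw [ENNReal.ofReal_le_iff_le_toReal (measure_ne_top _ _)]
  refine (probReal_compl_eq_one_sub MeasurableSet.of_discrete).symm.le.trans
    (measureReal_mono fun ω hω => ?_)
  rw [Set.mem_compl_iff, Set.mem_ofPred_eq, not_not] at hω
  exact ClusteringGame.classPoA_unitCoordinationGames_le ω.1 ω.2 (by linarith) hk hω
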